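/- Let $q\ge 1$ and let $S=\{u\in\mathbb{R}^q:\ u\ge 0,\ \|u\|=1\}$ be the positive orthant of the unit sphere ($\|\cdot\|$ is the Euclidean norm, $u\ge 0$ is meant componentwise). Let $\gamma=(\gamma_1,\dots,\gamma_q)$ be a map with values in $\mathbb{R}^q$, defined and twice differentiable in the closed orthant $\{u\ge 0\}$ near every point of $S$ (derivatives being one-sided on the boundary of the orthant). Suppose that for every $u\in S$ * $\gamma_\alpha(u)\ge 0$ for all $\alpha$, * (Marking Assumption) $u_\alpha=0\implies\gamma_\alpha(u)=0$ for all $\alpha$, * (conservation of probability) $\|\gamma(u)\|=1$. Put $T(u)=\sum_{\alpha}\bigl\{\|\nabla\gamma_\alpha(u)\|^2-(u\cdot\nabla\gamma_\alpha(u))^2\bigr\}$; this equals $\sum_\alpha\|\nabla\gamma_\alpha(u)\|^2$ if $\gamma$ does not depend on $\|u\|$. Then the maximum of $T$ over $S$ is attained and $$\max_{u\ge 0,\ \|u\|=1}T(u)\ \ge\ q-1 .$$ Likewise, whether or not $\gamma$ depends on $\|u\|$, the maximum of $\sum_\alpha\|\nabla\gamma_\alpha(u)\|^2$ over $S$ is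 attained and is at least $q-1$. -/

import Mathlib

open Set Filter Topology

noncomputable section

/-- The closed positive orthant `u ≥ 0` of Euclidean space `ℝ^q`. -/
def orthant (q : ℕ) : Set (EuclideanSpace ℝ (Fin q)) :=
  {u | ∀ α, 0 ≤ u α}

/-- The positive orthant of the unit sphere: `u ≥ 0` and `‖u‖ = 1`. -/
def sphereOrthant (q : ℕ) : Set (EuclideanSpace ℝ (Fin q)) :=
  {u | u ∈ orthant q ∧ ‖u‖ = 1}

/-- `f` is twice differentiable at `x` relative to `s`: it is differentiable relative to `s` at all
points of `s` near `x`, and its derivative is differentiable at `x` relative to `s`. -/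
def TwiceDifferentiableWithinAt {E F : Type*} [NormedAddCommGroup E] [NormedSpace ℝ E]
    [NormedAddCommGroup F] [NormedSpace ℝ F] (f : E → F) (s : Set E) (x : E) : Prop :=
  (∀ᶠ y in 𝓝[s] x, DifferentiableWithinAt ℝ f s y) ∧
    DifferentiableWithinAt ℝ (fderivWithin ℝ f s) s x

/-- The gradient `∇γ_α(u)`, one-sided where `u` lies on the boundary of the orthant. -/
def attackGradient {q : ℕ} (γ : EuclideanSpace ℝ (Fin q) → EuclideanSpace ℝ (Fin q))
    (α : Fin q) (u : EuclideanSpace ℝ (Fin q)) : EuclideanSpace ℝ (Fin q) :=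
  gradientWithin (fun v => γ v α) (orthant q) u

/-- `∑_α ‖∇γ_α(u)‖²`. -/
def gradientPayoff {q : ℕ} (γ : EuclideanSpace ℝ (Fin q) → EuclideanSpace ℝ (Fin q))
    (u : EuclideanSpace ℝ (Fin q)) : ℝ :=
  ∑ α, ‖attackGradient γ α u‖ ^ 2

/-- The payoff `T(u) = ∑_α (‖∇γ_α(u)‖² - (u · ∇γ_α(u))²)`. For `‖u‖ = 1` it depends only on `γ` on
the unit sphere, and it equals `∑_α ‖∇γ_α(u)‖²` when `γ` does not depend on `‖u‖`. -/
def payoff {q : ℕ} (γ : EuclideanSpace ℝ (Fin q) → EuclideanSpace ℝ (Fin q))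
    (u : EuclideanSpace ℝ (Fin q)) : ℝ :=
  ∑ α, (‖attackGradient γ α u‖ ^ 2 - (inner ℝ u (attackGradient γ α u)) ^ 2)

end

/-!
The coordinate function `u_α` is a positive function on the spherical orthant `S`, vanishes on the
face `u_α = 0`, has zero normal derivative on the other faces, and satisfies
`-Δ_S u_α = (q - 1) u_α`. It is therefore the first eigenfunction of the Laplacian with mixed
Dirichlet and Neumann conditions, with eigenvalue `q - 1`. The Marking Assumption says that
`γ_α` satisfies the same Dirichlet condition, so `∫_S |∇_S γ_α|² ≥ (q - 1) ∫_S γ_α²`. Since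
`‖γ‖ = 1`, summing over `α` gives `∫_S T ≥ (q - 1) vol(S)`, and `T ≥ q - 1` at some point of `S`.

The eigenvalue bound comes from Picone's inequality (`picone_le`),
`|∇_S γ_α|² ≥ ∇_S u_α · ∇_S (γ_α² / u_α)`, which after summation reads
`T ≥ (q - 1) + div_S X` with `X = ∑_α (γ_α² / u_α) ∇_S u_α`. The field `X` is tangent to `S` and its
normal component vanishes on the boundary of `S`, because `γ_α` vanishes linearly on the
face `u_α = 0` (`exists_apply_le_mul`). Only first derivatives of `γ` enter.

To integrate `div_S X` with the divergence theorem for boxes, `X` is extended to the box `[0, 2]^q`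
as `piconeField`: constant along rays up to a power of the radius, times a cutoff `ψ(|x|²)` that
vanishes near the origin and near the outer faces. Since the field is tangent to the spheres around
the origin, differentiating `ψ` contributes nothing (`divergence_piconeField`). If `T < q - 1` held
on all of `S`, the divergence would be nonpositive in the box and negative where `ψ > 0`, while its
integral is zero (`ae_divergence_eq_zero`).
-/

open MeasureTheory

/-! ### The orthant and the spherical orthant -/

lemma convex_orthant (q : ℕ) : Convex ℝ (orthant q) := by
  intro x hx y hy a b ha hb _ α
  simpa using add_nonneg (mul_nonneg ha (hx α)) (mul_nonneg hb (hy α))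

lemma isClosed_orthant (q : ℕ) : IsClosed (orthant q) := by
  simp only [orthant, ofPred_forall]
  exact isClosed_iInter fun α => isClosed_le continuous_const (by fun_prop)

lemma orthant_mem_nhds {q : ℕ} {u : EuclideanSpace ℝ (Fin q)} (hu : ∀ α, 0 < u α) :
    orthant q ∈ 𝓝 u := by
  have h : IsOpen {v : EuclideanSpace ℝ (Fin q) | ∀ α, 0 < v α} := by
    simp only [ofPred_forall]
    exact isOpen_iInter_of_finite fun α => isOpen_lt continuous_const (by fun_prop)
  exact mem_of_superset (h.mem_nhds hu) fun v hv α => (hv α).le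

lemma uniqueDiffOn_orthant (q : ℕ) : UniqueDiffOn ℝ (orthant q) := by
  refine uniqueDiffOn_convex (convex_orthant q) ⟨WithLp.toLp 2 fun _ => 1, ?_⟩
  exact mem_interior_iff_mem_nhds.2 (orthant_mem_nhds fun α => by simp)

lemma isCompact_sphereOrthant (q : ℕ) : IsCompact (sphereOrthant q) := by
  have h : sphereOrthant q = orthant q ∩ Metric.sphere 0 1 := by
    ext u; simp [sphereOrthant]
  rw [h]
  exact (isCompact_sphere _ _).inter_left (isClosed_orthant q)

lemma sphereOrthant_nonempty {q : ℕ} (hq : 1 ≤ q) : (sphereOrthant q).Nonempty := by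
  refine ⟨EuclideanSpace.single ⟨0, hq⟩ 1, fun α => ?_, by simp⟩
  by_cases h : α = ⟨0, hq⟩ <;> simp [h]

lemma sphereOrthant_subset_orthant (q : ℕ) : sphereOrthant q ⊆ orthant q := fun _ hu => hu.1

lemma le_one_of_mem_sphereOrthant {q : ℕ} {u : EuclideanSpace ℝ (Fin q)}
    (hu : u ∈ sphereOrthant q) (α : Fin q) : u α ≤ 1 := by
  have h := PiLp.norm_apply_le u α
  rw [hu.2] at h
  exact (le_abs_self _).trans h

/-! ### Regularity of `γ` on the spherical orthant -/

section Regularity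

variable {q : ℕ} {γ : EuclideanSpace ℝ (Fin q) → EuclideanSpace ℝ (Fin q)}

lemma TwiceDifferentiableWithinAt.differentiableWithinAt {u : EuclideanSpace ℝ (Fin q)}
    (h : TwiceDifferentiableWithinAt γ (orthant q) u) (hu : u ∈ orthant q) :
    DifferentiableWithinAt ℝ γ (orthant q) u :=
  h.1.self_of_nhdsWithin hu

/-- The gradient `∇γ_α` represents the `α`-th component of the derivative of `γ`. -/
lemma inner_attackGradient {u : EuclideanSpace ℝ (Fin q)} (hu : u ∈ orthant q)
    (h : DifferentiableWithinAt ℝ γ (orthant q) u) (α : Fin q) (v : EuclideanSpace ℝ (Fin q)) :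
    inner ℝ (attackGradient γ α u) v = (fderivWithin ℝ γ (orthant q) u v) α := by
  have h1 : HasFDerivWithinAt (fun v => γ v α)
      ((EuclideanSpace.proj (𝕜 := ℝ) α).comp (fderivWithin ℝ γ (orthant q) u)) (orthant q) u :=
    (EuclideanSpace.proj (𝕜 := ℝ) α).hasFDerivAt.comp_hasFDerivWithinAt u h.hasFDerivWithinAt
  rw [attackGradient, gradientWithin, h1.fderivWithin (uniqueDiffOn_orthant q u hu)]
  simp

lemma continuousOn_attackGradient
    (hsmooth : ∀ u ∈ sphereOrthant q, TwiceDifferentiableWithinAt γ (orthant q) u) (α : Fin q) :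
    ContinuousOn (attackGradient γ α) (sphereOrthant q) := by
  have h1 : ContinuousOn (fderivWithin ℝ γ (orthant q)) (sphereOrthant q) := fun u hu =>
    (hsmooth u hu).2.continuousWithinAt.mono (sphereOrthant_subset_orthant q)
  have h2 : ContinuousOn (fun u => (InnerProductSpace.toDual ℝ (EuclideanSpace ℝ (Fin q))).symm
      ((EuclideanSpace.proj (𝕜 := ℝ) α).comp (fderivWithin ℝ γ (orthant q) u)))
      (sphereOrthant q) :=
    (LinearIsometryEquiv.continuous _).comp_continuousOn (continuousOn_const.clm_comp h1)
  refine h2.congr fun u hu => ?_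
  refine ext_inner_right ℝ fun v => ?_
  rw [inner_attackGradient hu.1 ((hsmooth u hu).differentiableWithinAt hu.1)]
  simp

lemma continuousOn_payoff
    (hsmooth : ∀ u ∈ sphereOrthant q, TwiceDifferentiableWithinAt γ (orthant q) u) :
    ContinuousOn (payoff γ) (sphereOrthant q) := by
  have h := continuousOn_attackGradient hsmooth
  unfold payoff
  refine continuousOn_finsetSum _ fun α _ => ?_
  exact ((h α).norm.pow 2).sub ((continuousOn_id.inner (h α)).pow 2)

lemma continuousOn_gradientPayoff
    (hsmooth : ∀ u ∈ sphereOrthant q, TwiceDifferentiableWithinAt γ (orthant q) u) :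
    ContinuousOn (gradientPayoff γ) (sphereOrthant q) := by
  have h := continuousOn_attackGradient hsmooth
  unfold gradientPayoff
  exact continuousOn_finsetSum _ fun α _ => (h α).norm.pow 2

lemma payoff_le_gradientPayoff (γ : EuclideanSpace ℝ (Fin q) → EuclideanSpace ℝ (Fin q))
    (u : EuclideanSpace ℝ (Fin q)) : payoff γ u ≤ gradientPayoff γ u :=
  Finset.sum_le_sum fun _ _ => sub_le_self _ (sq_nonneg _)

lemma exists_lipschitzOnWith_sphereOrthant
    (hsmooth : ∀ u ∈ sphereOrthant q, TwiceDifferentiableWithinAt γ (orthant q) u) :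
    ∃ K, LipschitzOnWith K γ (sphereOrthant q) := by
  refine LocallyLipschitzOn.exists_lipschitzOnWith_of_compact (isCompact_sphereOrthant q) ?_
  intro u hu
  obtain ⟨K, t, ht, hK⟩ := (convex_orthant q).exists_nhdsWithin_lipschitzOnWith_of_hasFDerivWithinAt
    ((hsmooth u hu).1.mono fun _ h => h.hasFDerivWithinAt) (hsmooth u hu).2.continuousWithinAt
  exact ⟨K, t, nhdsWithin_mono u (sphereOrthant_subset_orthant q) ht, hK⟩

/-- Each point of the spherical orthant other than the `α`-th vertex lies within distance
`2 * u α` of the face `u α = 0`: drop the coordinate `α` and renormalize. -/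
lemma exists_mem_face_dist_le {u : EuclideanSpace ℝ (Fin q)} (hu : u ∈ sphereOrthant q)
    {α : Fin q} (hα : u α < 1) :
    ∃ p ∈ sphereOrthant q, p α = 0 ∧ dist u p ≤ 2 * u α := by
  set w := u - EuclideanSpace.single α (u α) with hw
  have hwc : ∀ β, w β = if β = α then 0 else u β := by
    intro β
    by_cases h : β = α <;> simp [hw, h]
  have h0 := hu.1 α
  have hsq : ‖w‖ ^ 2 = 1 - u α ^ 2 := by
    have h1 : ‖w‖ ^ 2 = ‖u‖ ^ 2 - 2 * inner ℝ u (EuclideanSpace.single α (u α))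
        + ‖EuclideanSpace.single α (u α)‖ ^ 2 := norm_sub_sq_real _ _
    rw [h1, hu.2, EuclideanSpace.inner_single_right]
    simp
    ring
  have hpos : 0 < ‖w‖ := by
    refine lt_of_le_of_ne (norm_nonneg _) fun h => ?_
    rw [← h] at hsq
    nlinarith
  have hle : ‖w‖ ≤ 1 := by nlinarith
  refine ⟨‖w‖⁻¹ • w, ⟨fun β => ?_, ?_⟩, ?_, ?_⟩
  · have : 0 ≤ w β := by rw [hwc]; split_ifs; exacts [le_rfl, hu.1 β]
    simpa using mul_nonneg (inv_nonneg.2 hpos.le) this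
  · rw [norm_smul, norm_inv, norm_norm, inv_mul_cancel₀ hpos.ne']
  · simp [hwc]
  · have h1 : dist u w = u α := by
      rw [dist_eq_norm, hw, sub_sub_cancel]
      simp [abs_of_nonneg h0]
    have h2 : dist w (‖w‖⁻¹ • w) = 1 - ‖w‖ := by
      rw [dist_comm, dist_eq_norm, show ‖w‖⁻¹ • w - w = (‖w‖⁻¹ - 1) • w by module, norm_smul,
        Real.norm_of_nonneg (sub_nonneg.2 ((one_le_inv₀ hpos).2 hle)), sub_mul,
        inv_mul_cancel₀ hpos.ne', one_mul]
    have h3 := dist_triangle u w (‖w‖⁻¹ • w)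
    nlinarith

/-- The Marking Assumption makes `γ_α` vanish linearly on the face `u_α = 0`. -/
lemma exists_apply_le_mul
    (hsmooth : ∀ u ∈ sphereOrthant q, TwiceDifferentiableWithinAt γ (orthant q) u)
    (hmarking : ∀ u ∈ sphereOrthant q, ∀ α, u α = 0 → γ u α = 0)
    (hnorm : ∀ u ∈ sphereOrthant q, ‖γ u‖ = 1) :
    ∃ C : ℝ, 0 ≤ C ∧ ∀ u ∈ sphereOrthant q, ∀ α, γ u α ≤ C * u α := by
  obtain ⟨K, hK⟩ := exists_lipschitzOnWith_sphereOrthant hsmooth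
  refine ⟨2 * K + 1, by positivity, fun u hu α => ?_⟩
  have h0 := hu.1 α
  rcases (le_one_of_mem_sphereOrthant hu α).lt_or_eq with h1 | h1
  · obtain ⟨p, hp, hpα, hd⟩ := exists_mem_face_dist_le hu h1
    have h2 : γ u α - γ p α ≤ dist (γ u) (γ p) := by
      rw [dist_eq_norm]
      exact (le_abs_self _).trans (PiLp.norm_apply_le (γ u - γ p) α)
    have h3 := hK.dist_le_mul u hu p hp
    rw [hmarking p hp α hpα] at h2
    nlinarith [mul_le_mul_of_nonneg_left hd K.2]
  · have h2 := PiLp.norm_apply_le (γ u) α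
    rw [hnorm u hu] at h2
    have := (le_abs_self (γ u α)).trans h2
    rw [h1]
    nlinarith [K.2]

end Regularity

/-! ### The radial projection onto the sphere -/

section Direction

variable {q : ℕ}

/-- The radial projection `x ↦ x / ‖x‖` onto the unit sphere (with value `0` at `x = 0`), on the
product space `Fin q → ℝ`, where Lebesgue measure and boxes live. The square of the Euclidean
norm is spelled out as `∑ j, x j ^ 2`. -/
noncomputable def direction (x : Fin q → ℝ) : EuclideanSpace ℝ (Fin q) :=
  (√(∑ j, x j ^ 2))⁻¹ • WithLp.toLp 2 x

lemma direction_apply (x : Fin q → ℝ) (i : Fin q) :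
    direction x i = (√(∑ j, x j ^ 2))⁻¹ * x i := by
  simp [direction]

lemma direction_mem_sphereOrthant {x : Fin q → ℝ} (hx : ∀ i, 0 ≤ x i)
    (hs : 0 < ∑ j, x j ^ 2) : direction x ∈ sphereOrthant q := by
  refine ⟨fun i => ?_, ?_⟩
  · rw [direction_apply]
    exact mul_nonneg (by positivity) (hx i)
  · rw [direction, norm_smul, EuclideanSpace.norm_eq, norm_inv,
      Real.norm_of_nonneg (Real.sqrt_nonneg _)]
    simp only [Real.norm_eq_abs, sq_abs]
    exact inv_mul_cancel₀ (Real.sqrt_pos.2 hs).ne'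

lemma hasFDerivAt_sum_sq (x : Fin q → ℝ) :
    HasFDerivAt (fun x : Fin q → ℝ => ∑ j, x j ^ 2)
      (∑ j, (2 * x j) • ContinuousLinearMap.proj (R := ℝ) (φ := fun _ : Fin q => ℝ) j) x := by
  refine HasFDerivAt.fun_sum fun j _ => ?_
  have h := (hasFDerivAt_apply (𝕜 := ℝ) (F' := fun _ : Fin q => ℝ) j x).pow 2
  simpa using h

lemma continuousAt_direction {x : Fin q → ℝ} (hs : 0 < ∑ j, x j ^ 2) :
    ContinuousAt direction x := by
  have h : √(∑ j, x j ^ 2) ≠ 0 := (Real.sqrt_pos.2 hs).ne'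
  have h1 : ContinuousAt (fun x : Fin q → ℝ => √(∑ j, x j ^ 2)) x :=
    (hasFDerivAt_sum_sq x).continuousAt.sqrt
  exact (h1.inv₀ h).smul (PiLp.continuous_toLp 2 _).continuousAt

/-- The derivative of the radial projection is the tangential projection divided by `‖x‖`. -/
lemma exists_hasFDerivAt_direction {x : Fin q → ℝ} (hs : 0 < ∑ j, x j ^ 2) :
    ∃ L : (Fin q → ℝ) →L[ℝ] EuclideanSpace ℝ (Fin q), HasFDerivAt direction L x ∧
      ∀ v, L v = (√(∑ j, x j ^ 2))⁻¹ •
        (WithLp.toLp 2 v - inner ℝ (direction x) (WithLp.toLp 2 v) • direction x) := by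
  have hr := Real.sqrt_pos.2 hs
  have h1 := (hasDerivAt_inv hr.ne').comp_hasFDerivAt x ((hasFDerivAt_sum_sq x).sqrt hs.ne')
  have h2 := h1.smul (PiLp.hasFDerivAt_toLp (𝕜 := ℝ) 2 x)
  refine ⟨_, h2, fun v => ?_⟩
  have hin : inner ℝ (WithLp.toLp 2 x) (WithLp.toLp 2 v) = ∑ j, x j * v j := by
    simp [PiLp.inner_apply, mul_comm]
  have hsum : ∑ j, 2 * x j * v j = 2 * ∑ j, x j * v j := by
    rw [Finset.mul_sum]; simp [mul_assoc]
  ext i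
  simp [direction, inner_smul_left, hin, hsum]
  field_simp
  ring

end Direction

/-! ### The vector field -/

section Field

variable {q : ℕ} {γ : EuclideanSpace ℝ (Fin q) → EuclideanSpace ℝ (Fin q)} {ψ : ℝ → ℝ}

/-- The tangential gradient `∇γ_α - (u · ∇γ_α) u`. -/
noncomputable def tangentialGradient (γ : EuclideanSpace ℝ (Fin q) → EuclideanSpace ℝ (Fin q))
    (u : EuclideanSpace ℝ (Fin q)) (α : Fin q) : EuclideanSpace ℝ (Fin q) :=
  attackGradient γ α u - inner ℝ u (attackGradient γ α u) • u

/-- The vector field `ψ(|x|²) ∑_α γ_α(u)² / u_α • ∇u_α`, where `u = x / |x|` and `∇u_α` is the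
gradient of the coordinate function `x ↦ x_α / |x|`, written out using `‖γ(u)‖ = 1`. Where
`x_α = 0`, the convention `0 / 0 = 0` gives the `α`-th component the value `0`, which is its
continuous extension. -/
noncomputable def piconeField (γ : EuclideanSpace ℝ (Fin q) → EuclideanSpace ℝ (Fin q))
    (ψ : ℝ → ℝ) (α : Fin q) (x : Fin q → ℝ) : ℝ :=
  ψ (∑ j, x j ^ 2) * (γ (direction x) α ^ 2 / x α - x α / ∑ j, x j ^ 2)

lemma sum_sq_pos (hq : 1 ≤ q) {x : Fin q → ℝ} (hx : ∀ i, 0 < x i) : 0 < ∑ j, x j ^ 2 :=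
  Finset.sum_pos (fun j _ => pow_pos (hx j) 2) ⟨⟨0, hq⟩, Finset.mem_univ _⟩

lemma exists_hasFDerivAt_piconeField (hq : 1 ≤ q)
    (hsmooth : ∀ u ∈ sphereOrthant q, TwiceDifferentiableWithinAt γ (orthant q) u)
    (hψ : Differentiable ℝ ψ) {x : Fin q → ℝ} (hx : ∀ i, 0 < x i) (α : Fin q) :
    ∃ L : (Fin q → ℝ) →L[ℝ] ℝ, HasFDerivAt (piconeField γ ψ α) L x ∧
      L (Pi.single α 1) =
        deriv ψ (∑ j, x j ^ 2) * (2 * x α) *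
          (γ (direction x) α ^ 2 / x α - x α / ∑ j, x j ^ 2) +
        ψ (∑ j, x j ^ 2) *
          (2 * γ (direction x) α * tangentialGradient γ (direction x) α α /
              (√(∑ j, x j ^ 2) * x α) - γ (direction x) α ^ 2 / x α ^ 2 -
            1 / (∑ j, x j ^ 2) + 2 * x α ^ 2 / (∑ j, x j ^ 2) ^ 2) := by
  have hs := sum_sq_pos hq hx
  have hr := Real.sqrt_pos.2 hs
  have hu := direction_mem_sphereOrthant (fun i => (hx i).le) hs
  have hupos : ∀ i, 0 < direction x i := fun i => by
    rw [direction_apply]; exact mul_pos (inv_pos.2 hr) (hx i)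
  obtain ⟨N, hN, hNv⟩ := exists_hasFDerivAt_direction hs
  have hd := (hsmooth _ hu).differentiableWithinAt hu.1
  have hγ : HasFDerivAt γ (fderivWithin ℝ γ (orthant q) (direction x)) (direction x) :=
    hd.hasFDerivWithinAt.hasFDerivAt (orthant_mem_nhds hupos)
  have hg : HasFDerivAt (fun y => γ (direction y) α) ((EuclideanSpace.proj (𝕜 := ℝ) α).comp
      ((fderivWithin ℝ γ (orthant q) (direction x)).comp N)) x :=
    (EuclideanSpace.proj (𝕜 := ℝ) α).hasFDerivAt.comp x (hγ.comp x hN)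
  have hgv : ((EuclideanSpace.proj (𝕜 := ℝ) α).comp
      ((fderivWithin ℝ γ (orthant q) (direction x)).comp N)) (Pi.single α 1) =
      (√(∑ j, x j ^ 2))⁻¹ * tangentialGradient γ (direction x) α α := by
    have : ((EuclideanSpace.proj (𝕜 := ℝ) α).comp
        ((fderivWithin ℝ γ (orthant q) (direction x)).comp N)) (Pi.single α 1) =
        inner ℝ (attackGradient γ α (direction x)) (N (Pi.single α 1)) := by
      rw [inner_attackGradient hu.1 hd]; simp
    rw [this, hNv, inner_smul_right, inner_sub_right, inner_smul_right, PiLp.toLp_single,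
      EuclideanSpace.inner_single_right, EuclideanSpace.inner_single_right,
      real_inner_comm (direction x), tangentialGradient]
    simp [mul_comm]
  have hp := hasFDerivAt_apply (𝕜 := ℝ) (F' := fun _ : Fin q => ℝ) α x
  have hS := hasFDerivAt_sum_sq x
  have h1 := (hψ (∑ j, x j ^ 2)).hasDerivAt.comp_hasFDerivAt x hS
  have h2 := h1.mul (((hg.pow 2).mul ((hasDerivAt_inv (hx α).ne').comp_hasFDerivAt x hp)).sub
    (hp.mul ((hasDerivAt_inv hs.ne').comp_hasFDerivAt x hS)))
  refine ⟨_, h2, ?_⟩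
  simp only [add_apply, smul_apply, sub_apply, hgv]
  have hx' := (hx α).ne'
  simp [Pi.single_apply]
  generalize √(∑ j, x j ^ 2) = r at *
  generalize ∑ j, x j ^ 2 = s at *
  field_simp
  ring

end Field

/-! ### Continuity of the field up to the boundary -/

section Continuity

variable {q : ℕ} {γ : EuclideanSpace ℝ (Fin q) → EuclideanSpace ℝ (Fin q)} {ψ : ℝ → ℝ}

lemma tendsto_direction_nhdsWithin {x : Fin q → ℝ} (hs : 0 < ∑ j, x j ^ 2) :
    Tendsto direction (𝓝[Ici 0] x) (𝓝[sphereOrthant q] direction x) := by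
  refine tendsto_nhdsWithin_iff.2
    ⟨(continuousAt_direction hs).tendsto.mono_left nhdsWithin_le_nhds, ?_⟩
  have h : ∀ᶠ y in 𝓝[Ici 0] x, 0 < ∑ j, y j ^ 2 :=
    (hasFDerivAt_sum_sq x).continuousAt.continuousWithinAt.eventually (lt_mem_nhds hs)
  filter_upwards [h, self_mem_nhdsWithin] with y hy hy0
  exact direction_mem_sphereOrthant hy0 hy

/-- At a face `x_α = 0` the quotient `γ_α² / x_α` tends to its junk value `0`, because `γ_α`
vanishes linearly there. -/
lemma continuousWithinAt_sq_div (hγ : ContinuousOn γ (sphereOrthant q))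
    (hnonneg : ∀ u ∈ sphereOrthant q, ∀ α, 0 ≤ γ u α) {C : ℝ}
    (hC : ∀ u ∈ sphereOrthant q, ∀ α, γ u α ≤ C * u α) {x : Fin q → ℝ} (hx : 0 ≤ x)
    (hs : 0 < ∑ j, x j ^ 2) (α : Fin q) :
    ContinuousWithinAt (fun y => γ (direction y) α ^ 2 / y α) (Ici 0) x := by
  by_cases hα : x α = 0
  · have hS := (hasFDerivAt_sum_sq x).continuousAt.continuousWithinAt (s := Ici 0)
    have h0 : ∀ᶠ y in 𝓝[Ici 0] x, 0 < ∑ j, y j ^ 2 := hS.eventually (lt_mem_nhds hs)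
    have hlim : Tendsto (fun y : Fin q → ℝ => C ^ 2 * y α / ∑ j, y j ^ 2) (𝓝[Ici 0] x) (𝓝 0) := by
      have hp : ContinuousWithinAt (fun y : Fin q → ℝ => C ^ 2 * y α) (Ici 0) x :=
        (continuous_const.mul (continuous_apply α)).continuousWithinAt
      have h1 : ContinuousWithinAt (fun y : Fin q → ℝ => C ^ 2 * y α / ∑ j, y j ^ 2) (Ici 0) x :=
        hp.div hS hs.ne'
      simpa [ContinuousWithinAt, hα] using h1
    simp only [ContinuousWithinAt, hα, div_zero]
    refine tendsto_of_tendsto_of_tendsto_of_le_of_le' tendsto_const_nhds hlim ?_ ?_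
    · filter_upwards [self_mem_nhdsWithin] with y hy
      exact div_nonneg (sq_nonneg _) (hy α)
    · filter_upwards [self_mem_nhdsWithin, h0] with y hy hys
      rcases (hy α).eq_or_lt with h | h
      · have h : y α = 0 := h.symm
        simp [h]
      · have h : 0 < y α := h
        have hu := direction_mem_sphereOrthant hy hys
        have h2 : γ (direction y) α ^ 2 ≤ (C * direction y α) ^ 2 :=
          pow_le_pow_left₀ (hnonneg _ hu α) (hC _ hu α) 2
        rw [direction_apply, mul_pow, mul_pow, inv_pow, Real.sq_sqrt hys.le] at h2
        rw [div_le_iff₀ h]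
        refine h2.trans_eq ?_
        field_simp
  · have h1 : ContinuousWithinAt (fun y => γ (direction y)) (Ici 0) x :=
      (hγ _ (direction_mem_sphereOrthant hx hs)).tendsto.comp (tendsto_direction_nhdsWithin hs)
    have h2 : ContinuousWithinAt (fun y => γ (direction y) α) (Ici 0) x :=
      (EuclideanSpace.proj (𝕜 := ℝ) α).continuous.continuousAt.comp_continuousWithinAt h1
    exact (h2.pow 2).div (continuous_apply α).continuousWithinAt hα

lemma continuousOn_piconeField (hγ : ContinuousOn γ (sphereOrthant q))
    (hnonneg : ∀ u ∈ sphereOrthant q, ∀ α, 0 ≤ γ u α) {C : ℝ}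
    (hC : ∀ u ∈ sphereOrthant q, ∀ α, γ u α ≤ C * u α) (hψ : Continuous ψ)
    (hψ1 : ∀ s ≤ 1, ψ s = 0) (α : Fin q) :
    ContinuousOn (piconeField γ ψ α) (Ici 0) := by
  intro x hx
  have hS := (hasFDerivAt_sum_sq x).continuousAt
  rcases lt_or_ge (∑ j, x j ^ 2) 1 with hs | hs
  · have h : piconeField γ ψ α =ᶠ[𝓝 x] fun _ => 0 := by
      filter_upwards [hS.eventually (gt_mem_nhds hs)] with y hy
      simp [piconeField, hψ1 _ hy.le]
    exact (continuousAt_const.congr h.symm).continuousWithinAt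
  · have hs : 0 < ∑ j, x j ^ 2 := by linarith
    have h1 := (hψ.continuousAt.comp hS).continuousWithinAt (s := Ici 0)
    have h2 := (continuous_apply (A := fun _ : Fin q => ℝ) α).continuousWithinAt
      (x := x) (s := Ici 0)
    exact h1.mul ((continuousWithinAt_sq_div hγ hnonneg hC hx hs α).sub
      (h2.div hS.continuousWithinAt hs.ne'))

end Continuity

/-! ### The divergence of the field -/

section Divergence

variable {q : ℕ} {γ : EuclideanSpace ℝ (Fin q) → EuclideanSpace ℝ (Fin q)} {ψ : ℝ → ℝ}

lemma norm_sq_tangentialGradient {u : EuclideanSpace ℝ (Fin q)} (hu : ‖u‖ = 1) (α : Fin q) :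
    ‖tangentialGradient γ u α‖ ^ 2 =
      ‖attackGradient γ α u‖ ^ 2 - inner ℝ u (attackGradient γ α u) ^ 2 := by
  rw [tangentialGradient, norm_sub_sq_real, inner_smul_right, norm_smul, hu,
    real_inner_comm u, Real.norm_eq_abs, mul_one, sq_abs]
  ring

lemma inner_tangentialGradient {u : EuclideanSpace ℝ (Fin q)} (hu : ‖u‖ = 1) (α : Fin q) :
    inner ℝ (tangentialGradient γ u α) u = 0 := by
  rw [tangentialGradient, inner_sub_left, inner_smul_left, real_inner_self_eq_norm_sq, hu,
    real_inner_comm u]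
  simp

lemma sum_norm_sq_tangentialGradient {u : EuclideanSpace ℝ (Fin q)} (hu : ‖u‖ = 1) :
    ∑ α, ‖tangentialGradient γ u α‖ ^ 2 = payoff γ u :=
  Finset.sum_congr rfl fun α _ => norm_sq_tangentialGradient hu α

/-- Picone's inequality for `γ_α` against the coordinate function `u_α`: it expresses that
`‖∇γ_α - (γ_α / u_α) ∇u_α‖² ≥ 0` on the sphere, where `∇u_α` is the tangential part of the basis
vector `e_α`. -/
lemma picone_le {u : EuclideanSpace ℝ (Fin q)} (hu : ‖u‖ = 1) {α : Fin q} (hα : u α ≠ 0) :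
    2 * (γ u α / u α) * tangentialGradient γ u α α - (γ u α / u α) ^ 2 ≤
      ‖tangentialGradient γ u α‖ ^ 2 - γ u α ^ 2 := by
  set t := γ u α / u α with ht
  set e : EuclideanSpace ℝ (Fin q) := EuclideanSpace.single α 1 with he
  have ht' : γ u α = t * u α := by rw [ht]; field_simp
  have hv : ‖e - u α • u‖ ^ 2 = 1 - u α ^ 2 := by
    rw [norm_sub_sq_real, inner_smul_right, norm_smul, hu, he, EuclideanSpace.inner_single_left]
    simp
    ring
  have hav : inner ℝ (tangentialGradient γ u α) (e - u α • u) = tangentialGradient γ u α α := by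
    rw [inner_sub_right, inner_smul_right, inner_tangentialGradient hu, he,
      EuclideanSpace.inner_single_right]
    simp
  have h := sq_nonneg ‖tangentialGradient γ u α - t • (e - u α • u)‖
  rw [norm_sub_sq_real, inner_smul_right, norm_smul, mul_pow, hv, hav, Real.norm_eq_abs,
    sq_abs] at h
  rw [ht']
  linarith

lemma sq_tangentialGradient_apply_le (u : EuclideanSpace ℝ (Fin q)) (α : Fin q) :
    tangentialGradient γ u α α ^ 2 ≤ ‖tangentialGradient γ u α‖ ^ 2 := by
  rw [← sq_abs]
  exact pow_le_pow_left₀ (abs_nonneg _) (PiLp.norm_apply_le (tangentialGradient γ u α) α) 2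

lemma sum_sq_apply_eq_one {v : EuclideanSpace ℝ (Fin q)} (hv : ‖v‖ = 1) : ∑ α, v α ^ 2 = 1 := by
  rw [← EuclideanSpace.real_norm_sq_eq, hv, one_pow]

/-- The derivative of the cutoff `ψ` drops out of the divergence, since the field is tangent to
the spheres around the origin. -/
lemma divergence_piconeField (hq : 1 ≤ q)
    (hsmooth : ∀ u ∈ sphereOrthant q, TwiceDifferentiableWithinAt γ (orthant q) u)
    (hnorm : ∀ u ∈ sphereOrthant q, ‖γ u‖ = 1)
    (hψ : Differentiable ℝ ψ) {x : Fin q → ℝ} (hx : ∀ i, 0 < x i) :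
    ∑ α, fderiv ℝ (piconeField γ ψ α) x (Pi.single α 1) =
      ψ (∑ j, x j ^ 2) / (∑ j, x j ^ 2) *
        (∑ α, (2 * (γ (direction x) α / direction x α) * tangentialGradient γ (direction x) α α -
          (γ (direction x) α / direction x α) ^ 2) - (q : ℝ) + 2) := by
  have hs := sum_sq_pos hq hx
  have hr := Real.sqrt_pos.2 hs
  have hr2 := Real.sq_sqrt hs.le
  have hγ1 := sum_sq_apply_eq_one (hnorm _ (direction_mem_sphereOrthant (fun i => (hx i).le) hs))
  have key : ∀ α, fderiv ℝ (piconeField γ ψ α) x (Pi.single α 1) =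
      2 * deriv ψ (∑ j, x j ^ 2) * (γ (direction x) α ^ 2 - x α ^ 2 / ∑ j, x j ^ 2) +
      ψ (∑ j, x j ^ 2) / (∑ j, x j ^ 2) *
        ((2 * (γ (direction x) α / direction x α) * tangentialGradient γ (direction x) α α -
          (γ (direction x) α / direction x α) ^ 2) - 1 + 2 * (x α ^ 2 / ∑ j, x j ^ 2)) := by
    intro α
    obtain ⟨L, hL, hLα⟩ := exists_hasFDerivAt_piconeField hq hsmooth hψ hx α
    rw [hL.fderiv, hLα, direction_apply]
    have hxα := (hx α).ne'
    generalize √(∑ j, x j ^ 2) = r at *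
    generalize ∑ j, x j ^ 2 = s at *
    subst hr2
    field_simp
  have hx1 : ∑ α, x α ^ 2 / ∑ j, x j ^ 2 = 1 := by
    rw [← Finset.sum_div, div_self hs.ne']
  rw [Finset.sum_congr rfl fun α _ => key α, Finset.sum_add_distrib, ← Finset.mul_sum,
    ← Finset.mul_sum, Finset.sum_sub_distrib, Finset.sum_add_distrib, Finset.sum_sub_distrib,
    ← Finset.mul_sum, hγ1, hx1]
  simp

lemma sum_picone_le {u : EuclideanSpace ℝ (Fin q)} (hu : ‖u‖ = 1) (hγ : ‖γ u‖ = 1)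
    (hα : ∀ α, u α ≠ 0) :
    ∑ α, (2 * (γ u α / u α) * tangentialGradient γ u α α - (γ u α / u α) ^ 2) ≤
      payoff γ u - 1 := by
  rw [← sum_norm_sq_tangentialGradient hu, ← sum_sq_apply_eq_one hγ, ← Finset.sum_sub_distrib]
  exact Finset.sum_le_sum fun α _ => picone_le hu (hα α)

lemma le_sum_picone {u : EuclideanSpace ℝ (Fin q)} (hu : ‖u‖ = 1) (hα : ∀ α, 0 < u α)
    (hγ : ∀ α, 0 ≤ γ u α) {C : ℝ} (hC : ∀ α, γ u α ≤ C * u α) :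
    -(payoff γ u + q * (2 * C ^ 2)) ≤
      ∑ α, (2 * (γ u α / u α) * tangentialGradient γ u α α - (γ u α / u α) ^ 2) := by
  have h : ∀ α, -(‖tangentialGradient γ u α‖ ^ 2 + 2 * C ^ 2) ≤
      2 * (γ u α / u α) * tangentialGradient γ u α α - (γ u α / u α) ^ 2 := by
    intro α
    have h1 : (γ u α / u α) ^ 2 ≤ C ^ 2 :=
      pow_le_pow_left₀ (div_nonneg (hγ α) (hα α).le) ((div_le_iff₀ (hα α)).2 (hC α)) 2
    nlinarith [sq_nonneg (γ u α / u α + tangentialGradient γ u α α),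
      sq_tangentialGradient_apply_le (γ := γ) u α]
  calc _ = ∑ α, -(‖tangentialGradient γ u α‖ ^ 2 + 2 * C ^ 2) := by
        rw [Finset.sum_neg_distrib, Finset.sum_add_distrib, sum_norm_sq_tangentialGradient hu]
        simp
    _ ≤ _ := Finset.sum_le_sum fun α _ => h α

end Divergence

/-! ### Integration -/

/-- A cutoff for the squared radius. -/
lemma exists_cutoff : ∃ ψ : ℝ → ℝ, Differentiable ℝ ψ ∧ (∀ s, 0 ≤ ψ s) ∧ (∀ s, ψ s ≤ 1) ∧
    (∀ s ≤ 1, ψ s = 0) ∧ (∀ s, 3 ≤ s → ψ s = 0) ∧ 0 < ψ 2 := by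
  let f : ContDiffBump (2 : ℝ) := ⟨1 / 2, 1, by norm_num, by norm_num⟩
  refine ⟨f, (f.contDiff (n := 1)).differentiable (by norm_num), fun s => f.nonneg,
    fun s => f.le_one, fun s hs => f.zero_of_le_dist ?_, fun s hs => f.zero_of_le_dist ?_,
    f.pos_of_mem_ball (Metric.mem_ball_self f.rOut_pos)⟩
  · rw [Real.dist_eq, abs_sub_comm]
    exact (by linarith : (1 : ℝ) ≤ 2 - s).trans (le_abs_self _)
  · rw [Real.dist_eq]
    exact (by linarith : (1 : ℝ) ≤ s - 2).trans (le_abs_self _)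

/-- The divergence of a field that is continuous on a box, differentiable inside it with bounded
divergence, and has vanishing normal component on all faces, cannot be nonpositive without
vanishing almost everywhere. -/
lemma ae_divergence_eq_zero {n : ℕ} {a b : Fin (n + 1) → ℝ} (hle : a ≤ b)
    (f : Fin (n + 1) → (Fin (n + 1) → ℝ) → ℝ) (hc : ∀ i, ContinuousOn (f i) (Icc a b))
    (hd : ∀ x ∈ univ.pi fun i => Ioo (a i) (b i), ∀ i, DifferentiableAt ℝ (f i) x)
    (ha : ∀ i, ∀ x, x i = a i → f i x = 0) (hb : ∀ i, ∀ x, x i = b i → f i x = 0) {B : ℝ}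
    (hB : ∀ x ∈ univ.pi fun i => Ioo (a i) (b i),
      -B ≤ ∑ i, fderiv ℝ (f i) x (Pi.single i 1))
    (hneg : ∀ x ∈ univ.pi fun i => Ioo (a i) (b i),
      ∑ i, fderiv ℝ (f i) x (Pi.single i 1) ≤ 0) :
    ∀ᵐ x, x ∈ (univ.pi fun i => Ioo (a i) (b i)) →
      ∑ i, fderiv ℝ (f i) x (Pi.single i 1) = 0 := by
  set D : (Fin (n + 1) → ℝ) → ℝ := fun x => ∑ i, fderiv ℝ (f i) x (Pi.single i 1) with hD
  have hae : (univ.pi fun i => Ioo (a i) (b i)) =ᵐ[volume] Icc a b := Measure.univ_pi_Ioo_ae_eq_Icc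
  have hmeas : MeasurableSet (univ.pi fun i => Ioo (a i) (b i)) :=
    MeasurableSet.univ_pi fun i => measurableSet_Ioo
  have hDm : Measurable D :=
    Finset.measurable_sum _ fun i _ => measurable_fderiv_apply_const ℝ (f i) _
  have hint : IntegrableOn D (univ.pi fun i => Ioo (a i) (b i)) := by
    refine IntegrableOn.of_bound ?_ hDm.aestronglyMeasurable B ?_
    · rw [measure_congr hae]; exact isCompact_Icc.measure_lt_top
    · refine (ae_restrict_iff' hmeas).2 (ae_of_all _ fun x hx => ?_)
      rw [Real.norm_eq_abs, abs_of_nonpos (hneg x hx)]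
      linarith [hB x hx]
  have hzero : ∫ x in Icc a b, D x = 0 := by
    rw [hD, integral_divergence_of_hasFDerivAt_off_countable' a b hle f
      (fun i => fderiv ℝ (f i)) ∅ countable_empty hc
      (fun x hx i => (hd x hx.1 i).hasFDerivAt) (hint.congr_set_ae hae.symm)]
    refine Finset.sum_eq_zero fun i _ => ?_
    simp [ha i, hb i]
  rw [← setIntegral_congr_set hae] at hzero
  have h := (setIntegral_eq_zero_iff_of_nonneg_ae (f := fun x => -D x)
    ((ae_restrict_iff' hmeas).2 (ae_of_all _ fun x hx => neg_nonneg.2 (hneg x hx))) hint.neg).1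
    (by rw [integral_neg, hzero, neg_zero])
  filter_upwards [(ae_restrict_iff' hmeas).1 h] with x hx hxm
  simpa using hx hxm

/-- The pointwise form of `∫ T ≥ (q - 1) vol(S)`. -/
lemma exists_le_payoff {q : ℕ} (hq : 1 ≤ q)
    {γ : EuclideanSpace ℝ (Fin q) → EuclideanSpace ℝ (Fin q)}
    (hsmooth : ∀ u ∈ sphereOrthant q, TwiceDifferentiableWithinAt γ (orthant q) u)
    (hnonneg : ∀ u ∈ sphereOrthant q, ∀ α, 0 ≤ γ u α)
    (hmarking : ∀ u ∈ sphereOrthant q, ∀ α, u α = 0 → γ u α = 0)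
    (hnorm : ∀ u ∈ sphereOrthant q, ‖γ u‖ = 1) :
    ∃ u ∈ sphereOrthant q, (q : ℝ) - 1 ≤ payoff γ u := by
  by_contra! hlt
  obtain ⟨C, -, hC⟩ := exists_apply_le_mul hsmooth hmarking hnorm
  obtain ⟨ψ, hψ, hψ0, hψ1, hψl, hψr, hψ2⟩ := exists_cutoff
  have hγc : ContinuousOn γ (sphereOrthant q) := fun u hu =>
    ((hsmooth u hu).differentiableWithinAt hu.1).continuousWithinAt.mono
      (sphereOrthant_subset_orthant q)
  have hdir : ∀ x : Fin q → ℝ, (∀ i, 0 < x i) →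
      direction x ∈ sphereOrthant q ∧ ∀ i, 0 < direction x i := fun x hx =>
    ⟨direction_mem_sphereOrthant (fun i => (hx i).le) (sum_sq_pos hq hx), fun i => by
      rw [direction_apply]
      exact mul_pos (inv_pos.2 (Real.sqrt_pos.2 (sum_sq_pos hq hx))) (hx i)⟩
  have hw0 : ∀ x : Fin q → ℝ, 0 ≤ ψ (∑ j, x j ^ 2) / ∑ j, x j ^ 2 := fun x =>
    div_nonneg (hψ0 _) (Finset.sum_nonneg fun j _ => sq_nonneg _)
  have hw1 : ∀ x : Fin q → ℝ, ψ (∑ j, x j ^ 2) / ∑ j, x j ^ 2 ≤ 1 := by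
    intro x
    rcases le_total (∑ j, x j ^ 2) 1 with h | h
    · simp [hψl _ h]
    · exact (div_le_one (by linarith)).2 ((hψ1 _).trans h)
  have hneg : ∀ x : Fin q → ℝ, (∀ i, 0 < x i) →
      ∑ α, (2 * (γ (direction x) α / direction x α) * tangentialGradient γ (direction x) α α -
          (γ (direction x) α / direction x α) ^ 2) - (q : ℝ) + 2 < 0 := by
    intro x hx
    have h := hdir x hx
    linarith [hlt _ h.1, sum_picone_le h.1.2 (hnorm _ h.1) fun α => (h.2 α).ne']
  obtain ⟨n, rfl⟩ : ∃ n, q = n + 1 := ⟨q - 1, by omega⟩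
  -- On the outer faces `x i = 2` the squared radius is at least `4`, outside the support of `ψ`.
  have hae := ae_divergence_eq_zero (a := 0) (b := fun _ => 2) (fun _ => zero_le_two)
    (piconeField γ ψ)
    (fun i => (continuousOn_piconeField hγc hnonneg hC hψ.continuous hψl i).mono
      fun x hx => hx.1)
    (fun x hx i => by
      obtain ⟨L, hL, -⟩ := exists_hasFDerivAt_piconeField hq hsmooth hψ
        (fun j => (hx j (mem_univ j)).1) i
      exact hL.differentiableAt)
    (fun i x hx => by simp [piconeField, show x i = 0 from hx])
    (fun i x hx => by
      have h4 : x i ^ 2 ≤ ∑ j, x j ^ 2 :=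
        Finset.single_le_sum (f := fun j => x j ^ 2) (fun j _ => sq_nonneg _) (Finset.mem_univ i)
      rw [show x i = 2 from hx] at h4
      rw [piconeField, hψr _ (by linarith), zero_mul])
    (B := 2 * (n + 1 : ℕ) + (n + 1 : ℕ) * (2 * C ^ 2))
    (fun x hx => by
      have hx0 : ∀ i, 0 < x i := fun i => (hx i (mem_univ i)).1
      have h := hdir x hx0
      have hlow := le_sum_picone h.1.2 h.2 (hnonneg _ h.1) (hC _ h.1)
      rw [divergence_piconeField hq hsmooth hnorm hψ hx0]
      nlinarith [hw0 x, hw1 x, hneg x hx0, hlt _ h.1])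
    (fun x hx => by
      have hx0 : ∀ i, 0 < x i := fun i => (hx i (mem_univ i)).1
      rw [divergence_piconeField hq hsmooth hnorm hψ hx0]
      exact mul_nonpos_of_nonneg_of_nonpos (hw0 x) (hneg x hx0).le)
  set U : Set (Fin (n + 1) → ℝ) :=
    (univ.pi fun _ => Ioo 0 2) ∩ {x | 0 < ψ (∑ j, x j ^ 2)} with hU
  have hUo : IsOpen U := by
    refine (isOpen_set_pi finite_univ fun _ _ => isOpen_Ioo).inter
      (isOpen_lt continuous_const (hψ.continuous.comp ?_))
    exact continuous_iff_continuousAt.2 fun x => (hasFDerivAt_sum_sq x).continuousAt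
  -- The point on the diagonal with squared radius `2`.
  have hUne : U.Nonempty := by
    have hn : (0 : ℝ) < n + 1 := by positivity
    refine ⟨fun _ => √(2 / (n + 1)), fun _ _ => ⟨Real.sqrt_pos.2 (by positivity), ?_⟩, ?_⟩
    · rw [Real.sqrt_lt' two_pos, div_lt_iff₀ hn]
      nlinarith
    · have h2 : ∑ _j : Fin (n + 1), √(2 / (n + 1 : ℝ)) ^ 2 = 2 := by
        rw [Real.sq_sqrt (by positivity), Finset.sum_const, Finset.card_univ, Fintype.card_fin,
          nsmul_eq_mul, Nat.cast_succ]
        field_simp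
      simpa only [mem_ofPred_eq, h2] using hψ2
  obtain ⟨x, hxU, hx⟩ := (Measure.dense_of_ae hae).inter_open_nonempty U hUo hUne
  have hx0 : ∀ i, 0 < x i := fun i => (hxU.1 i (mem_univ i)).1
  have h0 := hx hxU.1
  rw [divergence_piconeField hq hsmooth hnorm hψ hx0] at h0
  exact (mul_neg_of_pos_of_neg (div_pos hxU.2 (sum_sq_pos hq hx0)) (hneg x hx0)).ne h0

theorem theorem1 (q : ℕ) (hq : 1 ≤ q)
    (γ : EuclideanSpace ℝ (Fin q) → EuclideanSpace ℝ (Fin q))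
    (hsmooth : ∀ u ∈ sphereOrthant q, TwiceDifferentiableWithinAt γ (orthant q) u)
    (hnonneg : ∀ u ∈ sphereOrthant q, ∀ α, 0 ≤ γ u α)
    (hmarking : ∀ u ∈ sphereOrthant q, ∀ α, u α = 0 → γ u α = 0)
    (hnorm : ∀ u ∈ sphereOrthant q, ‖γ u‖ = 1) :
    (∃ u ∈ sphereOrthant q, IsMaxOn (payoff γ) (sphereOrthant q) u ∧
        (q : ℝ) - 1 ≤ payoff γ u) ∧
      (∃ u ∈ sphereOrthant q, IsMaxOn (gradientPayoff γ) (sphereOrthant q) u ∧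
        (q : ℝ) - 1 ≤ gradientPayoff γ u) := by
  obtain ⟨v, hv, hle⟩ := exists_le_payoff hq hsmooth hnonneg hmarking hnorm
  obtain ⟨u, hu, hmax⟩ := (isCompact_sphereOrthant q).exists_isMaxOn
    (sphereOrthant_nonempty hq) (continuousOn_payoff hsmooth)
  obtain ⟨w, hw, hmax'⟩ := (isCompact_sphereOrthant q).exists_isMaxOn
    (sphereOrthant_nonempty hq) (continuousOn_gradientPayoff hsmooth)
  exact ⟨⟨u, hu, hmax, hle.trans (hmax hv)⟩,
    ⟨w, hw, hmax', (hle.trans (payoff_le_gradientPayoff γ v)).trans (hmax' hv)⟩⟩
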